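/- Fix a non-empty finite set $V$ of variables. Terms of the calculus of relations (CoR) over $V$ are given by $$t,s ::= a \mid \bot \mid \top \mid t\cup s \mid t\cap s \mid t^{-} \mid \mathsf{I} \mid \mathsf{D} \mid t\cdot s \mid t\dagger s \mid t^{\pi}\qquad (a\in V,\ \pi\colon\{1,2\}\to\{1,2\}).$$ A structure $\mathfrak A$ is a non-empty set $|\mathfrak A|$ together with a binary relation $a^{\mathfrak A}\subseteq|\mathfrak A|^2$ for each $a\in V$. A term $t$ denotes a binary relation $[\![t]\!]_{\mathfrak A}\subseteq|\mathfrak A|^2$: a variable $a$ denotes $a^{\mathfrak A}$; $\bot,\top,\cup,\cap,{}^-$ denote the empty relation, $|\mathfrak A|^2$, union, intersection and complement in $|\mathfrak A|^2$; $\mathsf I$ and $\mathsf D$ denote $\{(x,y)\mid x=y\}$ and $\{(x,y)\mid x\ne y\}$; and for relations $R,S$, $$R\cdot S=\{(x,y)\mid \exists z,\ (x,z)\in R\wedge(z,y)\in S\},\quad R\dagger S=\{(x,y)\mid\forall z,\ (x,z)\in R\vee(z,y)\in S\},\quad R^\pi=\{(x_1,x_2)\mid (x_{\pi(1)},x_{\pi(2)})\in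 R\}.$$ Write $t\sim s$ if $[\![t]\!]_{\mathfrak A}=[\![s]\!]_{\mathfrak A}$ for every structure $\mathfrak A$. The dot-dagger alternation hierarchy consists of the least sets of terms $\Sigma_n,\Pi_n$ ($n\in\mathbb N$) such that: - $\Sigma_0=\Pi_0$ is the set of terms containing neither $\cdot$ nor $\dagger$; - $\Sigma_n\cup\Pi_n\subseteq\Sigma_{n+1}\cap\Pi_{n+1}$ for $n\ge0$; - for $n\ge1$, if $t,s\in\Sigma_n$ then $t\cup s,\ t\cap s,\ t\cdot s,\ t^\pi\in\Sigma_n$ and $t\dagger s\in\Pi_{n+1}$; - for $n\ge1$, if $t,s\in\Pi_n$ then $t\cup s,\ t\cap s,\ t\dagger s,\ t^\pi\in\Pi_n$ and $t\cdot s\in\Sigma_{n+1}$. **Theorem.** For all $n,k\in\mathbb N$, the set of those terms in $\Sigma_n$ that contain at most $k$ occurrences of variables is finite modulo $\sim$; that is, it meets only finitely many $\sim$-equivalence classes. -/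

import Mathlib

universe u w

namespace CoR

/-- Terms of the calculus of relations over the set `V` of variables.  `proj t π` is the projection
term `t ^ π` for an arbitrary map `π` of the two-element index set (`0` stands for the source
coordinate, `1` for the target coordinate). -/
inductive Term (V : Type u) : Type u
  | var (a : V) : Term V
  | bot : Term V
  | top : Term V
  | union (s t : Term V) : Term V
  | inter (s t : Term V) : Term V
  | compl (t : Term V) : Term V
  | ident : Term V
  | diff : Term V
  | comp (s t : Term V) : Term V
  | dagger (s t : Term V) : Term V
  | proj (t : Term V) (π : Fin 2 → Fin 2) : Term V

/-- The number of occurrences of variables in a term. -/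
def Term.vo {V : Type u} : Term V → ℕ
  | .var _ => 1
  | .bot => 0
  | .top => 0
  | .union s t => s.vo + t.vo
  | .inter s t => s.vo + t.vo
  | .compl t => t.vo
  | .ident => 0
  | .diff => 0
  | .comp s t => s.vo + t.vo
  | .dagger s t => s.vo + t.vo
  | .proj t _ => t.vo

/-- The term contains neither composition nor dagger. -/
def Term.DotDaggerFree {V : Type u} : Term V → Prop
  | .var _ => True
  | .bot => True
  | .top => True
  | .union s t => s.DotDaggerFree ∧ t.DotDaggerFree
  | .inter s t => s.DotDaggerFree ∧ t.DotDaggerFree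
  | .compl t => t.DotDaggerFree
  | .ident => True
  | .diff => True
  | .comp _ _ => False
  | .dagger _ _ => False
  | .proj t _ => t.DotDaggerFree

/-- A structure: a non-empty set with a binary relation for every variable. -/
structure Struct (V : Type u) : Type (max u (w + 1)) where
  carrier : Type w
  nonempty : Nonempty carrier
  rel : V → carrier → carrier → Prop

/-- The binary relation denoted by a term in a structure. -/
def Term.eval {V : Type u} (A : Struct.{u, w} V) : Term V → A.carrier → A.carrier → Prop
  | .var a => fun x y => A.rel a x y
  | .bot => fun _ _ => False
  | .top => fun _ _ => True
  | .union s t => fun x y => s.eval A x y ∨ t.eval A x y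
  | .inter s t => fun x y => s.eval A x y ∧ t.eval A x y
  | .compl t => fun x y => ¬ t.eval A x y
  | .ident => fun x y => x = y
  | .diff => fun x y => x ≠ y
  | .comp s t => fun x y => ∃ z, s.eval A x z ∧ t.eval A z y
  | .dagger s t => fun x y => ∀ z, s.eval A x z ∨ t.eval A z y
  | .proj t π => fun x y => t.eval A (![x, y] (π 0)) (![x, y] (π 1))

/-- Semantic equivalence of terms over all structures (with carrier in `Type w`). -/
def simREL (V : Type u) : Setoid (Term V) where
  r s t := ∀ A : Struct.{u, w} V, s.eval A = t.eval A
  iseqv := ⟨fun _ _ => rfl, fun h A => (h A).symm, fun h₁ h₂ A => (h₁ A).trans (h₂ A)⟩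

/-- The two families of the dot-dagger alternation hierarchy. -/
inductive Kind
  | sigma
  | pi

/-- The dot-dagger alternation hierarchy: `Level .sigma n t` says that `t` belongs to the `n`-th
`Σ` level and `Level .pi n t` that it belongs to the `n`-th `Π` level.  Both families are the least
ones that satisfy the closure rules below. -/
inductive Level {V : Type u} : Kind → ℕ → Term V → Prop
  | zero (κ : Kind) {t : Term V} : t.DotDaggerFree → Level κ 0 t
  | succ (κ κ' : Kind) {n : ℕ} {t : Term V} : Level κ n t → Level κ' (n + 1) t
  | union (κ : Kind) {n : ℕ} {s t : Term V} : 1 ≤ n → Level κ n s → Level κ n t →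
      Level κ n (.union s t)
  | inter (κ : Kind) {n : ℕ} {s t : Term V} : 1 ≤ n → Level κ n s → Level κ n t →
      Level κ n (.inter s t)
  | proj (κ : Kind) {n : ℕ} {t : Term V} (π : Fin 2 → Fin 2) : 1 ≤ n → Level κ n t →
      Level κ n (.proj t π)
  | comp_sigma {n : ℕ} {s t : Term V} : 1 ≤ n → Level .sigma n s → Level .sigma n t →
      Level .sigma n (.comp s t)
  | dagger_sigma {n : ℕ} {s t : Term V} : 1 ≤ n → Level .sigma n s → Level .sigma n t →
      Level .pi (n + 1) (.dagger s t)
  | dagger_pi {n : ℕ} {s t : Term V} : 1 ≤ n → Level .pi n s → Level .pi n t →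
      Level .pi n (.dagger s t)
  | comp_pi {n : ℕ} {s t : Term V} : 1 ≤ n → Level .pi n s → Level .pi n t →
      Level .sigma (n + 1) (.comp s t)

/-- The set of terms at the `n`-th `Σ` level. -/
def SigmaLevel (V : Type u) (n : ℕ) : Set (Term V) := {t | Level .sigma n t}

/-- The `k`-variable-occurrence fragment of a set of terms. -/
def voFragment {V : Type u} (T : Set (Term V)) (k : ℕ) : Set (Term V) := {t ∈ T | t.vo ≤ k}

/-- The quotient of a set of terms by semantic equivalence over all structures. -/
abbrev QuoREL {V : Type u} (T : Set (Term V)) : Type u :=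
  Quotient ((simREL.{u, w} V).comap (Subtype.val : T → Term V))

end CoR

/-! Induction on the number of variable occurrences. On structures with more than four elements a
variable-free term denotes a relation depending only on whether `x = y`, so only finitely many such
constants exist. In a term with at most `k + 1` occurrences, every binary operation either has a
variable-free operand, hence a constant one, or splits into two operands with at most `k`
occurrences each. Above a split, or above a subterm of a lower level, the context is a chain of
projections and binary operations with constants.

The point is that at a Σ level such a chain of any length collapses to one normal form, `η(x,y) ∨ ∃
a b, R(a,b) ∧ Θ(x,y,a,b)` with `η` and `Θ` pure equality conditions; a Π level gives the De Morgan
duals. There are finitely many such operators (`finite_kindOps`), so finitely many values of `R`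
give finitely many values of terms (`Level.relFam_mem_levelBound`, `finite_levelValues`). The
structures with at most four elements are finitely many up to isomorphism and are handled
separately. -/

namespace CoR

variable {V : Type u}

/-! ### Structures with more than four elements -/

/-- A type is large if it has more than four elements. -/
def Large (α : Type w) : Prop := ∀ s : Finset α, s.card ≤ 4 → ∃ z, z ∉ s

/-- The structures with more than four elements. -/
abbrev LargeStruct (V : Type u) : Type (max u (w + 1)) :=
  {A : Struct.{u, w} V // Large A.carrier}

/-- A choice of a binary relation on every large structure. -/
abbrev RelFam (V : Type u) : Type (max u (w + 1)) :=
  ∀ A : LargeStruct.{u, w} V, A.1.carrier → A.1.carrier → Prop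

/-- A choice of an `m`-ary relation on every large structure. -/
abbrev TupleFam (V : Type u) (m : ℕ) : Type (max u (w + 1)) :=
  ∀ A : LargeStruct.{u, w} V, (Fin m → A.1.carrier) → Prop

/-- The pattern of equalities between the entries of a tuple. -/
def eqPattern {α : Type w} {m : ℕ} (v : Fin m → α) : Fin m → Fin m → Prop :=
  fun i j => v i = v j

theorem eqPattern_eq_iff {α β : Type w} {m : ℕ} {v : Fin m → α} {v' : Fin m → β} :
    eqPattern v = eqPattern v' ↔ ∀ i j, v i = v j ↔ v' i = v' j := by
  simp only [funext_iff, eqPattern, eq_iff_iff]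

/-- A back-and-forth step: an old entry is matched by the corresponding entry, a new element by one
avoiding all entries. The tuples extended later are at most the quadruples `(x, y, a, b)`, whence
the threshold four. -/
theorem Large.exists_extend {α β : Type w} (hβ : Large β) {m : ℕ} (hm : m ≤ 4)
    {v : Fin m → α} {v' : Fin m → β} (h : eqPattern v = eqPattern v') (z : α) :
    ∃ z', ∀ i, v i = z ↔ v' i = z' := by
  classical
  rw [eqPattern_eq_iff] at h
  by_cases hz : ∃ i, v i = z
  · obtain ⟨i, rfl⟩ := hz
    exact ⟨v' i, fun j => h j i⟩
  · obtain ⟨z', hz'⟩ := hβ (Finset.univ.image v')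
      (Finset.card_image_le.trans (by simpa using hm))
    refine ⟨z', fun i => ⟨fun e => (hz ⟨i, e⟩).elim, fun e => (hz' ?_).elim⟩⟩
    exact Finset.mem_image.2 ⟨i, Finset.mem_univ _, e⟩

/-- A family of `m`-ary relations that only depends on the equality pattern of the arguments. -/
def TupleFam.Invariant {m : ℕ} (P : TupleFam.{u, w} V m) : Prop :=
  ∃ Q : (Fin m → Fin m → Prop) → Prop, ∀ A v, P A v ↔ Q (eqPattern v)

theorem TupleFam.Invariant.congr {m : ℕ} {P : TupleFam.{u, w} V m} (h : P.Invariant)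
    {A B : LargeStruct.{u, w} V} {v : Fin m → A.1.carrier} {v' : Fin m → B.1.carrier}
    (e : ∀ i j, v i = v j ↔ v' i = v' j) (hP : P A v) : P B v' := by
  obtain ⟨Q, hQ⟩ := h
  rw [hQ] at hP ⊢
  rwa [← eqPattern_eq_iff.2 e]

theorem TupleFam.invariant_of_congr {m : ℕ} {P : TupleFam.{u, w} V m}
    (h : ∀ (A B : LargeStruct.{u, w} V) (v : Fin m → A.1.carrier) (v' : Fin m → B.1.carrier),
      eqPattern v = eqPattern v' → P A v → P B v') : P.Invariant :=
  ⟨fun e => ∃ (A : LargeStruct.{u, w} V) (v : Fin m → A.1.carrier), eqPattern v = e ∧ P A v,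
    fun B v' => ⟨fun hP => ⟨B, v', rfl, hP⟩, fun ⟨A, v, e, hP⟩ => h A B v v' e hP⟩⟩

theorem TupleFam.finite_invariant (V : Type u) (m : ℕ) :
    {P : TupleFam.{u, w} V m | P.Invariant}.Finite := by
  refine (Set.finite_range fun (Q : (Fin m → Fin m → Prop) → Prop) =>
    (fun A v => Q (eqPattern v) : TupleFam.{u, w} V m)).subset ?_
  rintro P ⟨Q, hQ⟩
  exact ⟨Q, by funext A v; exact propext (hQ A v).symm⟩

/-- A family of binary relations that only depends on whether the arguments are equal. -/
def RelFam.Invariant (R : RelFam.{u, w} V) : Prop :=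
  ∃ Q : Prop → Prop, ∀ A x y, R A x y ↔ Q (x = y)

theorem RelFam.finite_invariant (V : Type u) : {R : RelFam.{u, w} V | R.Invariant}.Finite := by
  refine (Set.finite_range fun (Q : Prop → Prop) =>
    (fun A x y => Q (x = y) : RelFam.{u, w} V)).subset ?_
  rintro R ⟨Q, hQ⟩
  exact ⟨Q, by funext A x y; exact propext (hQ A x y).symm⟩

theorem RelFam.Invariant.congr {R : RelFam.{u, w} V} (h : R.Invariant)
    {A B : LargeStruct.{u, w} V} {x y : A.1.carrier} {x' y' : B.1.carrier}
    (e : x = y ↔ x' = y') (hR : R A x y) : R B x' y' := by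
  obtain ⟨Q, hQ⟩ := h
  rw [hQ] at hR ⊢
  rwa [← propext e]

theorem RelFam.invariant_of_congr {R : RelFam.{u, w} V}
    (h : ∀ (A B : LargeStruct.{u, w} V) (x y : A.1.carrier) (x' y' : B.1.carrier),
      (x = y ↔ x' = y') → R A x y → R B x' y') : R.Invariant :=
  ⟨fun e => ∃ (A : LargeStruct.{u, w} V) (x y : A.1.carrier), (x = y) = e ∧ R A x y,
    fun B x' y' => ⟨fun hR => ⟨B, x', y', rfl, hR⟩,
      fun ⟨A, x, y, e, hR⟩ => h A B x y x' y' (iff_of_eq e) hR⟩⟩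

/-! ### Operations on families of relations -/

/-- Composition of families of relations. -/
def RelFam.comp (R S : RelFam.{u, w} V) : RelFam.{u, w} V :=
  fun A x y => ∃ z, R A x z ∧ S A z y

/-- Dagger of families of relations. -/
def RelFam.dagger (R S : RelFam.{u, w} V) : RelFam.{u, w} V :=
  fun A x y => ∀ z, R A x z ∨ S A z y

/-- Projection of families of relations. -/
def RelFam.proj (π : Fin 2 → Fin 2) (R : RelFam.{u, w} V) : RelFam.{u, w} V :=
  fun A x y => R A (![x, y] (π 0)) (![x, y] (π 1))

theorem RelFam.compl_comp (R S : RelFam.{u, w} V) : (R.comp S)ᶜ = Rᶜ.dagger Sᶜ := by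
  funext A x y
  simp only [Pi.compl_apply, compl_iff_not, RelFam.comp, RelFam.dagger, not_exists, not_and_or]

theorem RelFam.compl_dagger (R S : RelFam.{u, w} V) : (R.dagger S)ᶜ = Rᶜ.comp Sᶜ := by
  rw [← compl_inj_iff, compl_compl, compl_comp, compl_compl, compl_compl]

namespace RelFam.Invariant

variable {R S : RelFam.{u, w} V}

theorem compl (hR : R.Invariant) : Rᶜ.Invariant := by
  obtain ⟨Q, hQ⟩ := hR
  exact ⟨fun e => ¬ Q e, fun A x y => not_congr (hQ A x y)⟩

theorem sup (hR : R.Invariant) (hS : S.Invariant) : (R ⊔ S).Invariant := by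
  obtain ⟨Q, hQ⟩ := hR
  obtain ⟨Q', hQ'⟩ := hS
  exact ⟨fun e => Q e ∨ Q' e, fun A x y => or_congr (hQ A x y) (hQ' A x y)⟩

theorem inf (hR : R.Invariant) (hS : S.Invariant) : (R ⊓ S).Invariant := by
  obtain ⟨Q, hQ⟩ := hR
  obtain ⟨Q', hQ'⟩ := hS
  exact ⟨fun e => Q e ∧ Q' e, fun A x y => and_congr (hQ A x y) (hQ' A x y)⟩

theorem proj (π : Fin 2 → Fin 2) (hR : R.Invariant) : (R.proj π).Invariant := by
  refine RelFam.invariant_of_congr fun A B x y x' y' e h => hR.congr ?_ h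
  generalize π 0 = i
  generalize π 1 = j
  fin_cases i <;> fin_cases j <;> simp [e, eq_comm (a := y), eq_comm (a := y')]

theorem comp (hR : R.Invariant) (hS : S.Invariant) : (R.comp S).Invariant := by
  refine RelFam.invariant_of_congr fun A B x y x' y' e ⟨z, h₁, h₂⟩ => ?_
  obtain ⟨z', hz'⟩ := B.2.exists_extend (m := 2) (by norm_num) (v := ![x, y]) (v' := ![x', y'])
    (eqPattern_eq_iff.2 (by simp [Fin.forall_fin_two, e, eq_comm (a := y), eq_comm (a := y')])) z
  simp only [Fin.forall_fin_two, Matrix.cons_val_zero, Matrix.cons_val_one] at hz'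
  exact ⟨z', hR.congr hz'.1 h₁, hS.congr (by rw [eq_comm, hz'.2, eq_comm]) h₂⟩

theorem dagger (hR : R.Invariant) (hS : S.Invariant) : (R.dagger S).Invariant := by
  have h := (hR.compl.comp hS.compl).compl
  rwa [compl_comp, compl_compl, compl_compl] at h

end RelFam.Invariant

/-! ### Existential operators and their duals -/

/-- The operator that joins a fixed relation with an existential image of its argument. -/
def existOp (η : RelFam.{u, w} V) (Θ : TupleFam.{u, w} V 4) (R : RelFam.{u, w} V) :
    RelFam.{u, w} V :=
  fun A x y => η A x y ∨ ∃ a b, R A a b ∧ Θ A ![x, y, a, b]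

/-- The operators `existOp η Θ` for invariant `η` and `Θ`. -/
def existOps (V : Type u) : Set (RelFam.{u, w} V → RelFam.{u, w} V) :=
  Set.image2 existOp {η | η.Invariant} {Θ | Θ.Invariant}

theorem finite_existOps (V : Type u) : (existOps.{u, w} V).Finite :=
  (RelFam.finite_invariant V).image2 _ (TupleFam.finite_invariant V 4)

/-- The De Morgan dual of an operator. -/
def dualOp (F : RelFam.{u, w} V → RelFam.{u, w} V) : RelFam.{u, w} V → RelFam.{u, w} V :=
  fun R => (F Rᶜ)ᶜ

theorem dualOp_dualOp (F : RelFam.{u, w} V → RelFam.{u, w} V) : dualOp (dualOp F) = F := by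
  funext R
  simp only [dualOp, compl_compl]

section existOps

variable {F : RelFam.{u, w} V → RelFam.{u, w} V} {c : RelFam.{u, w} V}

theorem id_mem_existOps : (fun R => R) ∈ existOps.{u, w} V := by
  refine ⟨⊥, ⟨fun _ => False, fun _ _ _ => Iff.rfl⟩, fun A v => v 0 = v 2 ∧ v 1 = v 3,
    ⟨fun e => e 0 2 ∧ e 1 3, fun _ _ => Iff.rfl⟩, ?_⟩
  funext R A x y
  simp [existOp]

theorem sup_mem_existOps (hF : F ∈ existOps V) (hc : c.Invariant) :
    (fun R => F R ⊔ c) ∈ existOps V := by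
  obtain ⟨η, hη, Θ, hΘ, rfl⟩ := hF
  refine ⟨η ⊔ c, hη.sup hc, Θ, hΘ, ?_⟩
  funext R A x y
  exact propext or_right_comm

/-- Since `c` concerns only `x` and `y`, it moves under `∃ a b` and into `Θ`. -/
theorem inf_mem_existOps (hF : F ∈ existOps V) (hc : c.Invariant) :
    (fun R => F R ⊓ c) ∈ existOps V := by
  obtain ⟨η, hη, Θ, hΘ, rfl⟩ := hF
  refine ⟨η ⊓ c, hη.inf hc, fun A v => Θ A v ∧ c A (v 0) (v 1),
    TupleFam.invariant_of_congr fun A B v v' e h => ?_, ?_⟩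
  · rw [eqPattern_eq_iff] at e
    exact ⟨hΘ.congr e h.1, hc.congr (e 0 1) h.2⟩
  · funext R A x y
    simp only [existOp, Pi.inf_apply, inf_Prop_eq, Matrix.cons_val_zero, Matrix.cons_val_one,
      ← and_assoc, ← exists_and_right, or_and_right]

theorem proj_mem_existOps (π : Fin 2 → Fin 2) (hF : F ∈ existOps V) :
    (fun R => (F R).proj π) ∈ existOps V := by
  obtain ⟨η, hη, Θ, hΘ, rfl⟩ := hF
  refine ⟨η.proj π, hη.proj π,
    fun A v => Θ A ![![v 0, v 1] (π 0), ![v 0, v 1] (π 1), v 2, v 3],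
    TupleFam.invariant_of_congr fun A B v v' e h => hΘ.congr ?_ h, rfl⟩
  rw [eqPattern_eq_iff] at e
  generalize π 0 = i
  generalize π 1 = j
  fin_cases i <;> fin_cases j <;> simp [Fin.forall_fin_succ, e]

/-- The `∃ z` of the composition commutes with `∨` and `∃ a b`, so it lands on `Θ`, where quantifier
elimination for pure equality removes it. A universal `z` would not commute, hence the dual family
for dagger. -/
theorem comp_left_mem_existOps (hF : F ∈ existOps V) (hc : c.Invariant) :
    (fun R => c.comp (F R)) ∈ existOps V := by
  obtain ⟨η, hη, Θ, hΘ, rfl⟩ := hF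
  refine ⟨c.comp η, hc.comp hη, fun A v => ∃ z, c A (v 0) z ∧ Θ A ![z, v 1, v 2, v 3],
    TupleFam.invariant_of_congr fun A B v v' e ⟨z, h₁, h₂⟩ => ?_, ?_⟩
  · obtain ⟨z', hz'⟩ := B.2.exists_extend le_rfl e z
    rw [eqPattern_eq_iff] at e
    have hz'' : ∀ i, z = v i ↔ z' = v' i := fun i => by rw [eq_comm, hz', eq_comm]
    exact ⟨z', hc.congr (hz' 0) h₁,
      hΘ.congr (by simp [Fin.forall_fin_succ, e, hz', hz'']) h₂⟩
  · funext R A x y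
    simp only [existOp, RelFam.comp, eq_iff_iff]
    constructor
    · rintro (⟨z, h₁, h₂⟩ | ⟨a, b, hR, z, h₁, h₂⟩)
      exacts [⟨z, h₁, .inl h₂⟩, ⟨z, h₁, .inr ⟨a, b, hR, h₂⟩⟩]
    · rintro ⟨z, h₁, h₂ | ⟨a, b, hR, h₂⟩⟩
      exacts [.inl ⟨z, h₁, h₂⟩, .inr ⟨a, b, hR, z, h₁, h₂⟩]

theorem comp_right_mem_existOps (hF : F ∈ existOps V) (hc : c.Invariant) :
    (fun R => (F R).comp c) ∈ existOps V := by
  -- Converse reverses composition, which reduces the claim to the left-hand case.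
  have hswap (R S : RelFam.{u, w} V) :
      R.comp S = ((S.proj ![1, 0]).comp (R.proj ![1, 0])).proj ![1, 0] := by
    funext A x y
    simp [RelFam.comp, RelFam.proj, and_comm]
  simp only [hswap _ c]
  exact proj_mem_existOps _ (comp_left_mem_existOps (proj_mem_existOps _ hF) (hc.proj _))

end existOps

/-- The operators that do not leave the levels of a given kind: the existential ones for `Σ` and
their De Morgan duals for `Π`. -/
def kindOps (V : Type u) : Kind → Set (RelFam.{u, w} V → RelFam.{u, w} V)
  | .sigma => existOps V
  | .pi => dualOp '' existOps V

theorem finite_kindOps (V : Type u) (κ : Kind) : (kindOps.{u, w} V κ).Finite := by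
  cases κ
  exacts [finite_existOps V, (finite_existOps V).image _]

/-- This reduces closure properties on the Π side to Σ ones by De Morgan: `⊔` and `⊓` trade places,
dagger becomes composition. -/
theorem mem_kindOps_pi {F : RelFam.{u, w} V → RelFam.{u, w} V} :
    F ∈ kindOps V .pi ↔ dualOp F ∈ existOps V :=
  ⟨fun ⟨G, hG, h⟩ => by rwa [← h, dualOp_dualOp], fun h => ⟨_, h, dualOp_dualOp F⟩⟩

section kindOps

variable {F : RelFam.{u, w} V → RelFam.{u, w} V} {c : RelFam.{u, w} V} {κ : Kind}

theorem id_mem_kindOps (κ : Kind) : (fun R => R) ∈ kindOps.{u, w} V κ := by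
  cases κ
  · exact id_mem_existOps
  · rw [mem_kindOps_pi]
    unfold dualOp
    simpa only [compl_compl] using id_mem_existOps

theorem sup_mem_kindOps (hF : F ∈ kindOps V κ) (hc : c.Invariant) :
    (fun R => F R ⊔ c) ∈ kindOps V κ := by
  cases κ
  · exact sup_mem_existOps hF hc
  · rw [mem_kindOps_pi] at hF ⊢
    unfold dualOp at hF ⊢
    simpa only [compl_sup] using inf_mem_existOps hF hc.compl

theorem inf_mem_kindOps (hF : F ∈ kindOps V κ) (hc : c.Invariant) :
    (fun R => F R ⊓ c) ∈ kindOps V κ := by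
  cases κ
  · exact inf_mem_existOps hF hc
  · rw [mem_kindOps_pi] at hF ⊢
    unfold dualOp at hF ⊢
    simpa only [compl_inf] using sup_mem_existOps hF hc.compl

theorem proj_mem_kindOps (π : Fin 2 → Fin 2) (hF : F ∈ kindOps V κ) :
    (fun R => (F R).proj π) ∈ kindOps V κ := by
  cases κ
  · exact proj_mem_existOps π hF
  · rw [mem_kindOps_pi] at hF ⊢
    exact proj_mem_existOps π hF

theorem dagger_left_mem_kindOps (hF : F ∈ kindOps V .pi) (hc : c.Invariant) :
    (fun R => c.dagger (F R)) ∈ kindOps V .pi := by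
  rw [mem_kindOps_pi] at hF ⊢
  unfold dualOp at hF ⊢
  simpa only [RelFam.compl_dagger] using comp_left_mem_existOps hF hc.compl

theorem dagger_right_mem_kindOps (hF : F ∈ kindOps V .pi) (hc : c.Invariant) :
    (fun R => (F R).dagger c) ∈ kindOps V .pi := by
  rw [mem_kindOps_pi] at hF ⊢
  unfold dualOp at hF ⊢
  simpa only [RelFam.compl_dagger] using comp_right_mem_existOps hF hc.compl

end kindOps

/-! ### Values of terms in large structures -/

/-- The family of relations that a term denotes in the large structures. -/
def Term.relFam (t : Term V) : RelFam.{u, w} V := fun A => t.eval A.1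

theorem Term.invariant_relFam {t : Term V} (h : t.vo = 0) :
    (t.relFam : RelFam.{u, w} V).Invariant := by
  induction t with
  | var a => simp [Term.vo] at h
  | bot => exact ⟨fun _ => False, fun _ _ _ => Iff.rfl⟩
  | top => exact ⟨fun _ => True, fun _ _ _ => Iff.rfl⟩
  | ident => exact ⟨fun e => e, fun _ _ _ => Iff.rfl⟩
  | diff => exact ⟨fun e => ¬ e, fun _ _ _ => Iff.rfl⟩
  | compl t ih => exact (ih h).compl
  | proj t π ih => exact (ih h).proj π
  | union s t ihs iht =>
    exact (ihs (Nat.add_eq_zero_iff.1 h).1).sup (iht (Nat.add_eq_zero_iff.1 h).2)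
  | inter s t ihs iht =>
    exact (ihs (Nat.add_eq_zero_iff.1 h).1).inf (iht (Nat.add_eq_zero_iff.1 h).2)
  | comp s t ihs iht =>
    exact (ihs (Nat.add_eq_zero_iff.1 h).1).comp (iht (Nat.add_eq_zero_iff.1 h).2)
  | dagger s t ihs iht =>
    exact (ihs (Nat.add_eq_zero_iff.1 h).1).dagger (iht (Nat.add_eq_zero_iff.1 h).2)

/-- The quantifier-free type of a pair of elements. -/
def Struct.pairType (A : Struct.{u, w} V) (x y : A.carrier) :
    (Fin 2 → Fin 2 → Prop) × (V → Fin 2 → Fin 2 → Prop) :=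
  (fun i j => ![x, y] i = ![x, y] j, fun a i j => A.rel a (![x, y] i) (![x, y] j))

theorem Struct.pairType_proj (A : Struct.{u, w} V) (π : Fin 2 → Fin 2) (x y : A.carrier) :
    A.pairType (![x, y] (π 0)) (![x, y] (π 1)) =
      (fun i j => (A.pairType x y).1 (π i) (π j),
        fun a i j => (A.pairType x y).2 a (π i) (π j)) := by
  have h : ![![x, y] (π 0), ![x, y] (π 1)] = fun i => ![x, y] (π i) := by
    funext i
    fin_cases i <;> rfl
  simp only [Struct.pairType, h]

/-- The families of relations that only depend on the quantifier-free type of the arguments. -/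
def localFams (V : Type u) : Set (RelFam.{u, w} V) :=
  Set.range fun (Q : (Fin 2 → Fin 2 → Prop) × (V → Fin 2 → Fin 2 → Prop) → Prop) A x y =>
    Q (A.1.pairType x y)

theorem Term.DotDaggerFree.relFam_mem_localFams {t : Term V} (h : t.DotDaggerFree) :
    (t.relFam : RelFam.{u, w} V) ∈ localFams V := by
  induction t with
  | var a => exact ⟨fun p => p.2 a 0 1, rfl⟩
  | bot => exact ⟨fun _ => False, rfl⟩
  | top => exact ⟨fun _ => True, rfl⟩
  | ident => exact ⟨fun p => p.1 0 1, rfl⟩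
  | diff => exact ⟨fun p => ¬ p.1 0 1, rfl⟩
  | compl t ih =>
    obtain ⟨Q, hQ⟩ := ih h
    exact ⟨fun p => ¬ Q p, congrArg (·ᶜ) hQ⟩
  | proj t π ih =>
    obtain ⟨Q, hQ⟩ := ih h
    refine ⟨fun p => Q (fun i j => p.1 (π i) (π j), fun a i j => p.2 a (π i) (π j)), ?_⟩
    simp only [← Struct.pairType_proj]
    exact congrArg (RelFam.proj π) hQ
  | union s t ihs iht =>
    obtain ⟨Q, hQ⟩ := ihs h.1
    obtain ⟨Q', hQ'⟩ := iht h.2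
    exact ⟨fun p => Q p ∨ Q' p, congrArg₂ (· ⊔ ·) hQ hQ'⟩
  | inter s t ihs iht =>
    obtain ⟨Q, hQ⟩ := ihs h.1
    obtain ⟨Q', hQ'⟩ := iht h.2
    exact ⟨fun p => Q p ∧ Q' p, congrArg₂ (· ⊓ ·) hQ hQ'⟩
  | comp s t => exact h.elim
  | dagger s t => exact h.elim

/-- All results of a binary operation of the calculus applied to members of a set. -/
def binaryImages (T : Set (RelFam.{u, w} V)) : Set (RelFam.{u, w} V) :=
  Set.image2 (· ⊔ ·) T T ∪ Set.image2 (· ⊓ ·) T T ∪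
    (Set.image2 RelFam.comp T T ∪ Set.image2 RelFam.dagger T T)

theorem finite_binaryImages {T : Set (RelFam.{u, w} V)} (hT : T.Finite) :
    (binaryImages T).Finite :=
  ((hT.image2 _ hT).union (hT.image2 _ hT)).union ((hT.image2 _ hT).union (hT.image2 _ hT))

/-- The values of the terms of a level with at most `k` occurrences of variables. -/
def levelValues (V : Type u) (k : ℕ) (κ : Kind) (n : ℕ) : Set (RelFam.{u, w} V) :=
  Term.relFam '' {t | Level κ n t ∧ t.vo ≤ k}

/-- An upper bound for `levelValues V (k + 1)` in terms of `levelValues V k`. -/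
def levelBound (V : Type u) (k : ℕ) : ℕ → Kind → Set (RelFam.{u, w} V)
  | 0, _ => localFams V
  | n + 1, κ => Set.image2 (fun F R => F R) (kindOps V κ)
      ((levelBound V k n .sigma ∪ levelBound V k n .pi) ∪
        binaryImages (levelValues V k κ (n + 1)))

/-- Finiteness of `V` enters at level 0, through the finite number of quantifier-free types. -/
theorem finite_levelBound [Finite V] {k : ℕ}
    (h : ∀ κ n, (levelValues.{u, w} V k κ n).Finite) (n : ℕ) (κ : Kind) :
    (levelBound.{u, w} V k n κ).Finite := by
  induction n generalizing κ with
  | zero => exact Set.finite_range _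
  | succ n ih =>
    exact (finite_kindOps V κ).image2 _
      (((ih .sigma).union (ih .pi)).union (finite_binaryImages (h κ (n + 1))))

theorem levelBound_subset_succ (V : Type u) (k n : ℕ) (κ κ' : Kind) :
    levelBound.{u, w} V k n κ ⊆ levelBound V k (n + 1) κ' := fun R hR =>
  ⟨_, id_mem_kindOps κ', R, .inl (by cases κ; exacts [.inl hR, .inr hR]), rfl⟩

/-- A variable-free operand is absorbed into the operator `F`. If both operands contain variables,
each has at most `k` occurrences, and the result is a new base value with `F` the identity. -/
theorem mem_levelBound_of_binary {k n : ℕ} {κ : Kind}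
    {op : RelFam.{u, w} V → RelFam.{u, w} V → RelFam.{u, w} V}
    (hop : Set.image2 op (levelValues V k κ (n + 1)) (levelValues V k κ (n + 1)) ⊆
      binaryImages (levelValues V k κ (n + 1)))
    (hleft : ∀ F ∈ kindOps V κ, ∀ c : RelFam.{u, w} V, c.Invariant →
      (fun R => op c (F R)) ∈ kindOps V κ)
    (hright : ∀ F ∈ kindOps V κ, ∀ c : RelFam.{u, w} V, c.Invariant →
      (fun R => op (F R) c) ∈ kindOps V κ)
    {s t : Term V} (hs : Level κ (n + 1) s) (ht : Level κ (n + 1) t)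
    (ihs : s.vo ≤ k + 1 → s.relFam ∈ levelBound.{u, w} V k (n + 1) κ)
    (iht : t.vo ≤ k + 1 → t.relFam ∈ levelBound.{u, w} V k (n + 1) κ)
    (hvo : s.vo + t.vo ≤ k + 1) :
    op s.relFam t.relFam ∈ levelBound V k (n + 1) κ := by
  by_cases hs0 : s.vo = 0
  · obtain ⟨F, hF, R, hR, e⟩ := iht (by omega)
    exact ⟨_, hleft F hF _ (Term.invariant_relFam hs0), R, hR, congrArg (op s.relFam) e⟩
  by_cases ht0 : t.vo = 0
  · obtain ⟨F, hF, R, hR, e⟩ := ihs (by omega)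
    exact ⟨_, hright F hF _ (Term.invariant_relFam ht0), R, hR, congrArg (op · t.relFam) e⟩
  exact ⟨_, id_mem_kindOps κ, _, .inr (hop ⟨_, ⟨s, ⟨hs, by omega⟩, rfl⟩,
    _, ⟨t, ⟨ht, by omega⟩, rfl⟩, rfl⟩), rfl⟩

/-- Complement occurs only in terms of level 0, so the operators need not be closed under it. -/
theorem Level.relFam_mem_levelBound {k n : ℕ} {κ : Kind} {t : Term V} (h : Level κ n t)
    (hvo : t.vo ≤ k + 1) : (t.relFam : RelFam.{u, w} V) ∈ levelBound V k n κ := by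
  have hcomp {n : ℕ} {s t : Term V} := mem_levelBound_of_binary (V := V) (k := k) (n := n)
    (κ := .sigma) (op := RelFam.comp.{u, w}) (fun _ h => .inr (.inl h))
    (fun _ hF _ hc => comp_left_mem_existOps hF hc)
    (fun _ hF _ hc => comp_right_mem_existOps hF hc) (s := s) (t := t)
  have hdagger {n : ℕ} {s t : Term V} := mem_levelBound_of_binary (V := V) (k := k) (n := n)
    (κ := .pi) (op := RelFam.dagger.{u, w}) (fun _ h => .inr (.inr h))
    (fun _ hF _ hc => dagger_left_mem_kindOps hF hc)
    (fun _ hF _ hc => dagger_right_mem_kindOps hF hc) (s := s) (t := t)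
  have hsucc {n : ℕ} (κ κ' : Kind) := @levelBound_subset_succ.{u, w} V k n κ κ'
  induction h with
  | zero κ h => exact h.relFam_mem_localFams
  | succ κ κ' h ih => exact hsucc κ κ' (ih hvo)
  | @union κ n s t hn hs ht ihs iht =>
    obtain ⟨n, rfl⟩ := Nat.exists_eq_add_of_le' hn
    exact mem_levelBound_of_binary (op := (· ⊔ ·)) (fun _ h => .inl (.inl h))
      (fun F hF c hc => by simpa only [sup_comm c] using sup_mem_kindOps hF hc)
      (fun _ hF _ hc => sup_mem_kindOps hF hc) hs ht ihs iht hvo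
  | @inter κ n s t hn hs ht ihs iht =>
    obtain ⟨n, rfl⟩ := Nat.exists_eq_add_of_le' hn
    exact mem_levelBound_of_binary (op := (· ⊓ ·)) (fun _ h => .inl (.inr h))
      (fun F hF c hc => by simpa only [inf_comm c] using inf_mem_kindOps hF hc)
      (fun _ hF _ hc => inf_mem_kindOps hF hc) hs ht ihs iht hvo
  | @proj κ n t π hn ht ih =>
    obtain ⟨n, rfl⟩ := Nat.exists_eq_add_of_le' hn
    obtain ⟨F, hF, R, hR, e⟩ := ih hvo
    exact ⟨_, proj_mem_kindOps π hF, R, hR, congrArg (RelFam.proj π) e⟩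
  | @comp_sigma n s t hn hs ht ihs iht =>
    obtain ⟨n, rfl⟩ := Nat.exists_eq_add_of_le' hn
    exact hcomp hs ht ihs iht hvo
  | dagger_sigma hn hs ht ihs iht =>
    -- The Σ operands are first lifted to the next Π level, where dagger is a native operation.
    exact hdagger (hs.succ _ _) (ht.succ _ _) (fun h => hsucc _ _ (ihs h))
      (fun h => hsucc _ _ (iht h)) hvo
  | @dagger_pi n s t hn hs ht ihs iht =>
    obtain ⟨n, rfl⟩ := Nat.exists_eq_add_of_le' hn
    exact hdagger hs ht ihs iht hvo
  | comp_pi hn hs ht ihs iht =>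
    exact hcomp (hs.succ _ _) (ht.succ _ _) (fun h => hsucc _ _ (ihs h))
      (fun h => hsucc _ _ (iht h)) hvo

theorem finite_levelValues [Finite V] (k : ℕ) (κ : Kind) (n : ℕ) :
    (levelValues.{u, w} V k κ n).Finite := by
  -- All kinds and levels at once: the bound for level `n` uses the `k`-values of both kinds at
  -- lower levels.
  induction k generalizing κ n with
  | zero =>
    refine (RelFam.finite_invariant V).subset ?_
    rintro _ ⟨t, ⟨-, ht⟩, rfl⟩
    exact Term.invariant_relFam (Nat.le_zero.1 ht)
  | succ k ih =>
    refine (finite_levelBound ih n κ).subset ?_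
    rintro _ ⟨t, ⟨h, ht⟩, rfl⟩
    exact h.relFam_mem_levelBound ht

/-! ### Values of terms in small structures -/

/-- The structure on `Fin (m + 1)` with given relations. -/
def finStruct (m : ℕ) (r : V → Fin (m + 1) → Fin (m + 1) → Prop) : Struct.{u, 0} V where
  carrier := Fin (m + 1)
  nonempty := ⟨0⟩
  rel := r

/-- The values of a term in the structures with at most four elements. -/
def Term.smallValues (t : Term V) :
    ∀ m : Fin 4, (V → Fin (m + 1) → Fin (m + 1) → Prop) → Fin (m + 1) → Fin (m + 1) → Prop :=
  fun m r => t.eval (finStruct m r)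

/-- Isomorphism invariance, across universes: the copy on `Fin (m + 1)` lives in `Type`. -/
theorem Term.eval_finStruct (A : Struct.{u, w} V) {m : ℕ} (e : A.carrier ≃ Fin (m + 1))
    (t : Term V) (x y : A.carrier) :
    t.eval (finStruct m fun a i j => A.rel a (e.symm i) (e.symm j)) (e x) (e y) ↔
      t.eval A x y := by
  induction t generalizing x y with
  | var a => simp [Term.eval, finStruct]
  | bot => rfl
  | top => rfl
  | ident => exact e.apply_eq_iff_eq
  | diff => exact not_congr e.apply_eq_iff_eq
  | compl t ih => exact not_congr (ih x y)
  | union s t ihs iht => exact or_congr (ihs x y) (iht x y)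
  | inter s t ihs iht => exact and_congr (ihs x y) (iht x y)
  | comp s t ihs iht =>
    exact (e.exists_congr fun z => and_congr (ihs x z).symm (iht z y).symm).symm
  | dagger s t ihs iht =>
    exact (e.forall_congr fun z => or_congr (ihs x z).symm (iht z y).symm).symm
  | proj t π ih =>
    have h (i : Fin 2) : ![e x, e y] i = e (![x, y] i) := by fin_cases i <;> rfl
    have := ih (![x, y] (π 0)) (![x, y] (π 1))
    rwa [← h, ← h] at this

theorem exists_equiv_fin_of_not_large {α : Type w} [Nonempty α] (h : ¬ Large α) :
    ∃ m : Fin 4, Nonempty (α ≃ Fin (m + 1)) := by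
  obtain ⟨s, hs, hz⟩ : ∃ s : Finset α, s.card ≤ 4 ∧ ∀ z, z ∈ s := by
    simpa [Large] using h
  let e := (Equiv.subtypeUnivEquiv hz).symm.trans s.equivFin
  have h0 : 0 < s.card := Finset.card_pos.2 ⟨_, hz (Classical.arbitrary α)⟩
  exact ⟨⟨s.card - 1, by omega⟩, ⟨e.trans (finCongr (by simp only; omega))⟩⟩

theorem simREL_of_values_eq {s t : Term V}
    (hlarge : (s.relFam : RelFam.{u, w} V) = t.relFam) (hsmall : s.smallValues = t.smallValues) :
    (simREL.{u, w} V) s t := by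
  intro A
  by_cases hA : Large A.carrier
  · exact congrFun hlarge ⟨A, hA⟩
  · have := A.nonempty
    obtain ⟨m, ⟨e⟩⟩ := exists_equiv_fin_of_not_large hA
    funext x y
    have h := congrFun (congrFun (congrFun (congrFun hsmall m)
      fun a i j => A.rel a (e.symm i) (e.symm j)) (e x)) (e y)
    exact propext ((s.eval_finStruct A e x y).symm.trans
      ((iff_of_eq h).trans (t.eval_finStruct A e x y)))

end CoR

theorem theorem4p1 (V : Type u) [Finite V] [Nonempty V] (n k : ℕ) :
    Finite (CoR.QuoREL.{u, w} (CoR.voFragment (CoR.SigmaLevel V n) k)) := by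
  have := (CoR.finite_levelValues.{u, w} (V := V) k .sigma n).to_subtype
  -- The second factor is finite because, for finite `V`, the type of all possible small values is
  -- finite.
  let f : CoR.QuoREL.{u, w} (CoR.voFragment (CoR.SigmaLevel V n) k) →
      CoR.levelValues.{u, w} V k .sigma n × Set.range (CoR.Term.smallValues (V := V)) :=
    fun q => (⟨q.out.1.relFam, q.out.1, q.out.2, rfl⟩, ⟨_, q.out.1, rfl⟩)
  refine Finite.of_injective f fun q q' h => ?_
  rw [Prod.ext_iff, Subtype.ext_iff, Subtype.ext_iff] at h
  exact Quotient.out_equiv_out.1 (CoR.simREL_of_values_eq h.1 h.2)
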